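/- Let $\mathbb H$ be the quaternions and $S^3\subset\mathbb H$ the unit quaternions. A quaternionic imaginary unit is a purely imaginary quaternion $\mathbf m$ with $|\mathbf m|=1$; put $\exp(\phi\,\mathbf m)=\cos\phi+\sin\phi\,\mathbf m$. For an imaginary unit $\mathbf c$, $\phi\in(0,\pi)$ and $\xi\in(0,\pi)$ let $$S(\mathbf c,\phi,\xi)=\{\exp(\phi\,\mathbf m):\langle\mathbf m,\mathbf c\rangle\ge\cos\xi\},\qquad bS(\mathbf c,\phi,\xi)=\{\exp(\phi\,\mathbf m):\langle\mathbf m,\mathbf c\rangle=\cos\xi\},$$ where $\mathbf m$ ranges over the imaginary units; $S(\mathbf c,\phi,\xi)$ is a cap of the $2$-sphere $\{\exp(\phi\,\mathbf m)\}$ and $bS(\mathbf c,\phi,\xi)$ is its boundary circle. For $U,V\subseteq S^3$ let $U\otimes V=\{\mathcal U\mathcal V:\mathcal U\in U,\ \mathcal V\in V\}$, and let $\partial$ denote the topological boundary in $S^3$. Let $\mathbf c_1,\mathbf c_2$ be imaginary units with $\mathbf c_1\ne\pm\mathbf c_2$ and let $\phi_1,\phi_2\in(0,\pi)$. Then there is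 $\varepsilon>0$ such that for all $\xi_1,\xi_2\in(0,\pi)$ with $\xi_1,\xi_2<\varepsilon$, writing $S_i=S(\mathbf c_i,\phi_i,\xi_i)$ and $bS_i=bS(\mathbf c_i,\phi_i,\xi_i)$: 1. the map $S_1\times S_2\to S^3$, $(\exp(\phi_1\mathbf m),\exp(\phi_2\mathbf n))\mapsto\exp(\phi_1\mathbf m)\exp(\phi_2\mathbf n)$, is a submersion, i.e. it is smooth and its differential is surjective at every point of $S_1\times S_2$ (boundary points included); 2. its image $S_1\otimes S_2$ is the closure in $S^3$ of an open subset of $S^3$; 3. $\partial(S_1\otimes S_2)\subseteq(bS_1\otimes S_2)\cup(S_1\otimes bS_2)$. Moreover both members of this union contain $bS_1\otimes bS_2$, and on the boundary $\partial(S_1\otimes S_2)$ they meet exactly in points of $bS_1\otimes bS_2$: $$\partial(S_1\otimes S_2)\cap(bS_1\otimes S_2)\cap(S_1\otimes bS_2)=\partial(S_1\otimes S_2)\cap(bS_1\otimes bS_2).$$ -/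

import Mathlib

open scoped Quaternion Manifold ContDiff Pointwise

noncomputable section

/-- The real subspace of pure vector (purely imaginary) quaternions, i.e. `ℝ³` inside `ℍ`,
with the inner product inherited from `ℍ = ℝ⁴`. -/
def pureQuaternions : Submodule ℝ ℍ[ℝ] where
  carrier := {q | q.re = 0}
  zero_mem' := rfl
  add_mem' := by
    intro a b ha hb
    simp only [Set.mem_ofPred_eq, Quaternion.re_add] at *
    rw [ha, hb, add_zero]
  smul_mem' := by
    intro r a ha
    simp only [Set.mem_ofPred_eq, Quaternion.re_smul] at *
    rw [ha, smul_zero]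

/-- The group `S³` of unit quaternions, with Mathlib's topology, smooth structure and group law. -/
abbrev UnitQuaternion : Type := Metric.sphere (0 : ℍ[ℝ]) 1

/-- The 2-sphere of quaternionic imaginary units, with Mathlib's smooth structure. -/
abbrev ImaginaryUnit : Type := Metric.sphere (0 : pureQuaternions) 1

instance fact_finrank_quaternion : Fact (Module.finrank ℝ ℍ[ℝ] = 3 + 1) :=
  ⟨Quaternion.finrank_eq_four⟩

theorem finrank_pureQuaternions : Module.finrank ℝ pureQuaternions = 3 := by
  let f : ℍ[ℝ] →ₗ[ℝ] ℝ :=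
    { toFun := fun q => q.re
      map_add' := fun _ _ => rfl
      map_smul' := fun _ _ => rfl }
  have hker : LinearMap.ker f = pureQuaternions := rfl
  have hf : Function.Surjective f := fun r => ⟨(r : ℍ[ℝ]), rfl⟩
  have h := f.finrank_range_add_finrank_ker
  rw [LinearMap.range_eq_top.mpr hf, finrank_top, Module.finrank_self, hker,
    Quaternion.finrank_eq_four] at h
  omega

instance fact_finrank_pureQuaternions : Fact (Module.finrank ℝ pureQuaternions = 2 + 1) :=
  ⟨finrank_pureQuaternions⟩

theorem norm_cos_add_sin_smul (φ : ℝ) (m : ImaginaryUnit) :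
    ‖((Real.cos φ : ℝ) : ℍ[ℝ]) + Real.sin φ • ((m : pureQuaternions) : ℍ[ℝ])‖ = 1 := by
  have hre : ((m : pureQuaternions) : ℍ[ℝ]).re = 0 := (m : pureQuaternions).2
  have hn : ‖((m : pureQuaternions) : ℍ[ℝ])‖ = 1 := by
    have h := norm_eq_of_mem_sphere m
    rwa [Submodule.coe_norm] at h
  have hsq : Quaternion.normSq ((m : pureQuaternions) : ℍ[ℝ]) = 1 := by
    rw [Quaternion.normSq_eq_norm_mul_self, hn, mul_one]
  rw [Quaternion.normSq_def', hre] at hsq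
  have key : Quaternion.normSq
      (((Real.cos φ : ℝ) : ℍ[ℝ]) + Real.sin φ • ((m : pureQuaternions) : ℍ[ℝ])) = 1 := by
    rw [Quaternion.normSq_def']
    simp only [Quaternion.re_add, Quaternion.imI_add, Quaternion.imJ_add, Quaternion.imK_add,
      Quaternion.re_coe, Quaternion.imI_coe, Quaternion.imJ_coe, Quaternion.imK_coe,
      Quaternion.re_smul, Quaternion.imI_smul, Quaternion.imJ_smul, Quaternion.imK_smul,
      hre, smul_eq_mul]
    linear_combination (Real.sin φ) ^ 2 * hsq + Real.sin_sq_add_cos_sq φ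
  rw [Quaternion.normSq_eq_norm_mul_self] at key
  nlinarith [norm_nonneg
    (((Real.cos φ : ℝ) : ℍ[ℝ]) + Real.sin φ • ((m : pureQuaternions) : ℍ[ℝ]))]

/-- `exp (φ m) = cos φ + sin φ m` as a unit quaternion, for an imaginary unit `m`. -/
def expUnit (φ : ℝ) (m : ImaginaryUnit) : UnitQuaternion :=
  ⟨((Real.cos φ : ℝ) : ℍ[ℝ]) + Real.sin φ • ((m : pureQuaternions) : ℍ[ℝ]),
    mem_sphere_zero_iff_norm.mpr (norm_cos_add_sin_smul φ m)⟩

/-- The imaginary units `m` with `⟨m, c⟩ ≥ cos ξ`: a cap (with its boundary) of the 2-sphere. -/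
def axisCap (c : ImaginaryUnit) (ξ : ℝ) : Set ImaginaryUnit :=
  {m | Real.cos ξ ≤ inner ℝ (m : pureQuaternions) (c : pureQuaternions)}

/-- The imaginary units `m` with `⟨m, c⟩ = cos ξ`. -/
def axisCircle (c : ImaginaryUnit) (ξ : ℝ) : Set ImaginaryUnit :=
  {m | inner ℝ (m : pureQuaternions) (c : pureQuaternions) = Real.cos ξ}

/-- `S(c, φ, ξ) = {exp (φ m) : ⟨m, c⟩ ≥ cos ξ}`. -/
def capS (c : ImaginaryUnit) (φ ξ : ℝ) : Set UnitQuaternion :=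
  expUnit φ '' axisCap c ξ

/-- `bS(c, φ, ξ) = {exp (φ m) : ⟨m, c⟩ = cos ξ}`. -/
def capBoundary (c : ImaginaryUnit) (φ ξ : ℝ) : Set UnitQuaternion :=
  expUnit φ '' axisCircle c ξ

/-- The map `(exp (φ₁ m), exp (φ₂ n)) ↦ exp (φ₁ m) exp (φ₂ n)`, read through the diffeomorphisms
`m ↦ exp (φᵢ m)` (`0 < φᵢ < π`) of the sphere of imaginary units onto the 2-sphere
`S(c, φᵢ, π)`. -/
def productMap (φ₁ φ₂ : ℝ) (p : ImaginaryUnit × ImaginaryUnit) : UnitQuaternion :=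
  expUnit φ₁ p.1 * expUnit φ₂ p.2

/-- The restriction of `f : M → N` to `s` is a submersion: `f` is smooth and its differential is
surjective at every point of `s`. It is used for subsets `s` that are submanifolds of codimension
`0` with boundary or corners, whose tangent space at each point (boundary points included) is the
whole tangent space of `M`. -/
def IsSubmersionOn {E H E' H' M N : Type*}
    [NormedAddCommGroup E] [NormedSpace ℝ E] [TopologicalSpace H] (I : ModelWithCorners ℝ E H)
    [NormedAddCommGroup E'] [NormedSpace ℝ E'] [TopologicalSpace H']
    (J : ModelWithCorners ℝ E' H')
    [TopologicalSpace M] [ChartedSpace H M] [TopologicalSpace N] [ChartedSpace H' N]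
    (f : M → N) (s : Set M) : Prop :=
  ContMDiff I J ∞ f ∧ ∀ x ∈ s, Function.Surjective (mfderiv I J f x)

end

/-! Write U = exp(φ₁ m), V = exp(φ₂ n). Translating the differential of (m, n) ↦ UV by U⁻¹ on the
left and V⁻¹ on the right turns its image into m⊥ + n⊥, which is all of ℝ³ exactly when m ≠ ±n. Caps
small enough to avoid equal or opposite points therefore give a submersion
(`surjective_mfderiv_productMap`). A submersion is open, so the product O of the open caps is open.
By compactness the product K of the caps is its closure. A point of ∂K avoids O, so each of its
preimages in the caps has a coordinate on a boundary circle. For the last claim, let w ∈ ∂K have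
preimages (m, n) with m on the first circle and (m', n') with n' on the second. If n is interior to
its cap, move along the fibre over w. Its first coordinates form the circle of latitude through m
about the axis Im w. Near m the second coordinate stays interior, so the first cannot enter the open
cap: ⟨·, c₁⟩ has a local maximum at m on this circle. A linear functional on a circle is a sinusoid,
so the maximum is global. Hence ⟨m', c₁⟩ ≤ cos ξ₁, and m' lies on the first circle
(`mem_axisCircle_of_productMap_eq`). -/

open Filter Topology

noncomputable section

/-! ### Submersions are open -/

/-- A `C¹` map between boundaryless manifolds whose differential at `x` is surjective maps
neighbourhoods of `x` onto neighbourhoods of `f x`. -/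
theorem ContMDiffAt.map_nhds_eq_of_surjective {E H E' H' M N : Type*}
    [NormedAddCommGroup E] [NormedSpace ℝ E] [CompleteSpace E] [TopologicalSpace H]
    {I : ModelWithCorners ℝ E H} [I.Boundaryless]
    [NormedAddCommGroup E'] [NormedSpace ℝ E'] [CompleteSpace E'] [TopologicalSpace H']
    {J : ModelWithCorners ℝ E' H'} [J.Boundaryless]
    [TopologicalSpace M] [ChartedSpace H M] [TopologicalSpace N] [ChartedSpace H' N]
    {f : M → N} {x : M} (hf : ContMDiffAt I J 1 f x)
    (hsurj : Function.Surjective (mfderiv I J f x)) :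
    map f (𝓝 x) = 𝓝 (f x) := by
  have hd := hf.mdifferentiableAt one_ne_zero
  rw [hd.mfderiv, I.range_eq_univ, fderivWithin_univ] at hsurj
  obtain ⟨hcont, hg⟩ := contMDiffAt_iff.mp hf
  rw [I.range_eq_univ, contDiffWithinAt_univ] at hg
  have hmap := (hg.hasStrictFDerivAt one_ne_zero).map_nhds_eq_of_surj
    (LinearMap.range_eq_top.mpr hsurj)
  have heq : f =ᶠ[𝓝 x] (extChartAt J (f x)).symm ∘
      (extChartAt J (f x) ∘ f ∘ (extChartAt I x).symm) ∘ extChartAt I x := by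
    filter_upwards [extChartAt_source_mem_nhds (I := I) x,
      hcont.preimage_mem_nhds (extChartAt_source_mem_nhds (I := J) (f x))] with y hy hy'
    simp only [Function.comp_apply, (extChartAt I x).left_inv hy]
    exact ((extChartAt J (f x)).left_inv hy').symm
  rw [map_congr heq, ← map_map, ← map_map, map_extChartAt_nhds_of_boundaryless, hmap]
  simp only [Function.comp_apply, extChartAt_to_inv]
  rw [← map_extChartAt_nhds_of_boundaryless, map_map]
  have hid : (extChartAt J (f x)).symm ∘ extChartAt J (f x) =ᶠ[𝓝 (f x)] id := by
    filter_upwards [extChartAt_source_mem_nhds (I := J) (f x)] with y hy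
    exact (extChartAt J (f x)).left_inv hy
  rw [map_congr hid, map_id]

/-! ### Coordinates on pure and unit quaternions -/

theorem pureQuaternions_re (x : pureQuaternions) : (x : ℍ[ℝ]).re = 0 := x.2

theorem pureQuaternions_inner (x y : pureQuaternions) :
    inner ℝ x y = (x : ℍ[ℝ]).imI * (y : ℍ[ℝ]).imI + (x : ℍ[ℝ]).imJ * (y : ℍ[ℝ]).imJ +
      (x : ℍ[ℝ]).imK * (y : ℍ[ℝ]).imK := by
  rw [Submodule.coe_inner, Quaternion.inner_def]
  simp [pureQuaternions_re]

theorem quaternion_inner (x y : ℍ[ℝ]) :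
    inner ℝ x y = x.re * y.re + x.imI * y.imI + x.imJ * y.imJ + x.imK * y.imK := by
  rw [Quaternion.inner_def]
  simp

theorem inner_self_imaginaryUnit (m : ImaginaryUnit) :
    inner ℝ (m : pureQuaternions) (m : pureQuaternions) = 1 := by
  rw [real_inner_self_eq_norm_sq, norm_eq_of_mem_sphere, one_pow]

theorem pureQuaternions_inner_smul_right (r : ℝ) (x y : pureQuaternions) :
    inner ℝ x (r • y) = r * inner ℝ x y := by
  simp only [pureQuaternions_inner, Submodule.coe_smul, Quaternion.imI_smul, Quaternion.imJ_smul,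
    Quaternion.imK_smul, smul_eq_mul]
  ring

theorem pureQuaternions_inner_smul_left (r : ℝ) (x y : pureQuaternions) :
    inner ℝ (r • x) y = r * inner ℝ x y := by
  rw [real_inner_comm, pureQuaternions_inner_smul_right, real_inner_comm]

/-- `cos φ + sin φ x` as a function of the pure quaternion `x`. -/
def affineQuaternion (φ : ℝ) (x : pureQuaternions) : ℍ[ℝ] :=
  ((Real.cos φ : ℝ) : ℍ[ℝ]) + Real.sin φ • (x : ℍ[ℝ])

theorem coe_expUnit (φ : ℝ) (m : ImaginaryUnit) :
    (expUnit φ m : ℍ[ℝ]) = affineQuaternion φ m := rfl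

theorem coe_productMap (φ₁ φ₂ : ℝ) (p : ImaginaryUnit × ImaginaryUnit) :
    (productMap φ₁ φ₂ p : ℍ[ℝ]) = affineQuaternion φ₁ p.1 * affineQuaternion φ₂ p.2 := rfl

theorem affineQuaternion_re (φ : ℝ) (x : pureQuaternions) :
    (affineQuaternion φ x).re = Real.cos φ := by
  simp [affineQuaternion, pureQuaternions_re]

theorem affineQuaternion_imI (φ : ℝ) (x : pureQuaternions) :
    (affineQuaternion φ x).imI = Real.sin φ * (x : ℍ[ℝ]).imI := by
  simp [affineQuaternion]

theorem affineQuaternion_imJ (φ : ℝ) (x : pureQuaternions) :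
    (affineQuaternion φ x).imJ = Real.sin φ * (x : ℍ[ℝ]).imJ := by
  simp [affineQuaternion]

theorem affineQuaternion_imK (φ : ℝ) (x : pureQuaternions) :
    (affineQuaternion φ x).imK = Real.sin φ * (x : ℍ[ℝ]).imK := by
  simp [affineQuaternion]

theorem unitQuaternion_mul_star (u : UnitQuaternion) : (u : ℍ[ℝ]) * star (u : ℍ[ℝ]) = 1 := by
  rw [Quaternion.self_mul_star, Quaternion.normSq_eq_norm_mul_self, norm_eq_of_mem_sphere]
  simp

theorem unitQuaternion_star_mul (u : UnitQuaternion) : star (u : ℍ[ℝ]) * (u : ℍ[ℝ]) = 1 := by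
  rw [Quaternion.star_mul_self, Quaternion.normSq_eq_norm_mul_self, norm_eq_of_mem_sphere]
  simp

/-! ### The differential of the product map -/

theorem hasFDerivAt_affineQuaternion (φ : ℝ) (x : pureQuaternions) :
    HasFDerivAt (affineQuaternion φ) (Real.sin φ • pureQuaternions.subtypeL) x :=
  ((pureQuaternions.subtypeL.hasFDerivAt (x := x)).const_smul (Real.sin φ)).const_add _

theorem contDiff_affineQuaternion (φ : ℝ) : ContDiff ℝ ∞ (affineQuaternion φ) :=
  contDiff_const.add (pureQuaternions.subtypeL.contDiff.const_smul (Real.sin φ))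

theorem contMDiff_productMap (φ₁ φ₂ : ℝ) :
    ContMDiff ((𝓡 2).prod (𝓡 2)) (𝓡 3) ∞ (productMap φ₁ φ₂) := by
  have h1 : ContMDiff ((𝓡 2).prod (𝓡 2)) 𝓘(ℝ, ℍ[ℝ]) ∞
      (fun p : ImaginaryUnit × ImaginaryUnit => affineQuaternion φ₁ p.1) :=
    (contDiff_affineQuaternion φ₁).contMDiff.comp (contMDiff_coe_sphere.comp contMDiff_fst)
  have h2 : ContMDiff ((𝓡 2).prod (𝓡 2)) 𝓘(ℝ, ℍ[ℝ]) ∞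
      (fun p : ImaginaryUnit × ImaginaryUnit => affineQuaternion φ₂ p.2) :=
    (contDiff_affineQuaternion φ₂).contMDiff.comp (contMDiff_coe_sphere.comp contMDiff_snd)
  exact (((ContinuousLinearMap.mul ℝ ℍ[ℝ]).isBoundedBilinearMap.contDiff).contMDiff.comp
    (h1.prodMk_space h2)).codRestrict_sphere fun p => (productMap φ₁ φ₂ p).2

theorem inner_sq_lt_one {m n : ImaginaryUnit} (hne : m ≠ n) (hne' : m ≠ -n) :
    inner ℝ (m : pureQuaternions) (n : pureQuaternions) ^ 2 < 1 := by
  have hm := norm_eq_of_mem_sphere m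
  have hn := norm_eq_of_mem_sphere n
  have h1 : inner ℝ (m : pureQuaternions) (n : pureQuaternions) < 1 :=
    (inner_lt_one_iff_real_of_norm_eq_one hm hn).mpr fun h => hne (Subtype.ext h)
  have h2 : inner ℝ (m : pureQuaternions) (-(n : pureQuaternions)) < 1 :=
    (inner_lt_one_iff_real_of_norm_eq_one hm (by rwa [norm_neg])).mpr
      fun h => hne' (Subtype.ext h)
  rw [inner_neg_right] at h2
  nlinarith

/-- If `m ≠ ±n`, the planes `m⊥` and `n⊥` span the space of pure quaternions. -/
theorem exists_add_of_inner_eq_zero {m n : ImaginaryUnit} (hne : m ≠ n) (hne' : m ≠ -n)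
    (z : pureQuaternions) : ∃ a b : pureQuaternions,
      inner ℝ (m : pureQuaternions) a = 0 ∧ inner ℝ (n : pureQuaternions) b = 0 ∧ a + b = z := by
  have hd := inner_sq_lt_one hne hne'
  set d := inner ℝ (m : pureQuaternions) (n : pureQuaternions) with hd_def
  have hd' : 1 - d ^ 2 ≠ 0 := by linarith
  -- The part of `m` orthogonal to `n`, scaled so that `⟨m, b⟩ = ⟨m, z⟩`.
  let b : pureQuaternions := (inner ℝ (m : pureQuaternions) z / (1 - d ^ 2)) •
    ((m : pureQuaternions) - d • (n : pureQuaternions))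
  refine ⟨z - b, b, ?_, ?_, sub_add_cancel _ _⟩
  · simp only [b, inner_sub_right, pureQuaternions_inner_smul_right, inner_self_imaginaryUnit, ← hd_def]
    field_simp
    ring
  · simp only [b, inner_sub_right, pureQuaternions_inner_smul_right, inner_self_imaginaryUnit,
      real_inner_comm (m : pureQuaternions) (n : pureQuaternions), ← hd_def]
    simp

/-- Split U⁻¹ z V⁻¹ = a + b with a ⟂ m and b ⟂ n. Left multiplication by U = cos φ₁ + sin φ₁ m
preserves the plane m⊥, and right multiplication by V preserves n⊥, so Ua and bV give the tangent
vectors. -/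
theorem exists_tangent_of_inner_eq_zero {φ₁ φ₂ : ℝ} (h₁ : Real.sin φ₁ ≠ 0) (h₂ : Real.sin φ₂ ≠ 0)
    {m n : ImaginaryUnit} (hne : m ≠ n) (hne' : m ≠ -n) (z : ℍ[ℝ])
    (hz : inner ℝ (affineQuaternion φ₁ m * affineQuaternion φ₂ n) z = 0) :
    ∃ u v : pureQuaternions, inner ℝ (m : pureQuaternions) u = 0 ∧
      inner ℝ (n : pureQuaternions) v = 0 ∧
      affineQuaternion φ₁ m * (Real.sin φ₂ • (v : ℍ[ℝ])) +
        (Real.sin φ₁ • (u : ℍ[ℝ])) * affineQuaternion φ₂ n = z := by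
  set U := affineQuaternion φ₁ m with hU
  set V := affineQuaternion φ₂ n with hV
  have hUU : U * star U = 1 := unitQuaternion_mul_star (expUnit φ₁ m)
  have hVV : star V * V = 1 := unitQuaternion_star_mul (expUnit φ₂ n)
  -- By cyclicity of the real part, this is the inner product of `U * V` with `z`.
  have hpure : (star U * z * star V).re = 0 := by
    rw [quaternion_inner] at hz
    simp only [Quaternion.re_mul, Quaternion.imI_mul, Quaternion.imJ_mul, Quaternion.imK_mul,
      Quaternion.re_star, Quaternion.imI_star, Quaternion.imJ_star, Quaternion.imK_star] at hz ⊢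
    linear_combination hz
  obtain ⟨a, b, ha, hb, hab⟩ :=
    exists_add_of_inner_eq_zero hne hne' (⟨star U * z * star V, hpure⟩ : pureQuaternions)
  have hab' : (a : ℍ[ℝ]) + b = star U * z * star V := congrArg Subtype.val hab
  rw [pureQuaternions_inner] at ha hb
  have hUa : (U * (a : ℍ[ℝ])).re = 0 := by
    simp only [hU, Quaternion.re_mul, affineQuaternion_re, affineQuaternion_imI,
      affineQuaternion_imJ, affineQuaternion_imK, pureQuaternions_re]
    linear_combination -Real.sin φ₁ * ha
  have hbV : ((b : ℍ[ℝ]) * V).re = 0 := by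
    simp only [hV, Quaternion.re_mul, affineQuaternion_re, affineQuaternion_imI,
      affineQuaternion_imJ, affineQuaternion_imK, pureQuaternions_re]
    linear_combination -Real.sin φ₂ * hb
  refine ⟨(Real.sin φ₁)⁻¹ • (⟨U * a, hUa⟩ : pureQuaternions),
    (Real.sin φ₂)⁻¹ • (⟨b * V, hbV⟩ : pureQuaternions), ?_, ?_, ?_⟩
  · rw [pureQuaternions_inner_smul_right, pureQuaternions_inner]
    simp only [hU, Quaternion.imI_mul, Quaternion.imJ_mul, Quaternion.imK_mul, affineQuaternion_re,
      affineQuaternion_imI, affineQuaternion_imJ, affineQuaternion_imK, pureQuaternions_re]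
    linear_combination (Real.sin φ₁)⁻¹ * Real.cos φ₁ * ha
  · rw [pureQuaternions_inner_smul_right, pureQuaternions_inner]
    simp only [hV, Quaternion.imI_mul, Quaternion.imJ_mul, Quaternion.imK_mul, affineQuaternion_re,
      affineQuaternion_imI, affineQuaternion_imJ, affineQuaternion_imK, pureQuaternions_re]
    linear_combination (Real.sin φ₂)⁻¹ * Real.cos φ₂ * hb
  · simp only [Submodule.coe_smul, smul_smul, mul_inv_cancel₀ h₁, mul_inv_cancel₀ h₂, one_smul]
    calc U * (b * V) + U * a * V = U * (a + b) * V := by noncomm_ring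
      _ = (U * star U) * z * (star V * V) := by rw [hab']; noncomm_ring
      _ = z := by rw [hUU, hVV, one_mul, mul_one]

theorem mem_range_mfderiv_coe_imaginaryUnit {m : ImaginaryUnit} {u : pureQuaternions}
    (hu : inner ℝ (m : pureQuaternions) u = 0) :
    ∃ t : TangentSpace (𝓡 2) m,
      mfderiv (𝓡 2) 𝓘(ℝ, pureQuaternions) ((↑) : ImaginaryUnit → pureQuaternions) m t = u := by
  have h := range_mvfderiv_subtypeVal (n := 2) m
  have hu' : u ∈ (ℝ ∙ (m : pureQuaternions))ᗮ :=
    Submodule.mem_orthogonal_singleton_iff_inner_right.mpr hu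
  rw [← h] at hu'
  exact hu'

theorem surjective_mfderiv_productMap {φ₁ φ₂ : ℝ} (h₁ : Real.sin φ₁ ≠ 0) (h₂ : Real.sin φ₂ ≠ 0)
    {p : ImaginaryUnit × ImaginaryUnit} (hne : p.1 ≠ p.2) (hne' : p.1 ≠ -p.2) :
    Function.Surjective (mfderiv ((𝓡 2).prod (𝓡 2)) (𝓡 3) (productMap φ₁ φ₂) p) := by
  intro ξ
  have hd : MDifferentiableAt ((𝓡 2).prod (𝓡 2)) (𝓡 3) (productMap φ₁ φ₂) p :=
    (contMDiff_productMap φ₁ φ₂ p).mdifferentiableAt (by simp)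
  have hι : MDifferentiableAt (𝓡 3) 𝓘(ℝ, ℍ[ℝ]) ((↑) : UnitQuaternion → ℍ[ℝ])
      (productMap φ₁ φ₂ p) :=
    (contMDiff_coe_sphere (m := 1) _).mdifferentiableAt one_ne_zero
  have hcoe (m : ImaginaryUnit) : MDifferentiableAt (𝓡 2) 𝓘(ℝ, pureQuaternions)
      ((↑) : ImaginaryUnit → pureQuaternions) m :=
    (contMDiff_coe_sphere (m := 1) _).mdifferentiableAt one_ne_zero
  have hG1 := (hasFDerivAt_affineQuaternion φ₁ p.1).hasMFDerivAt.comp p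
    ((hcoe p.1).hasMFDerivAt.comp p (hasMFDerivAt_fst (I := 𝓡 2) (I' := 𝓡 2) p))
  have hG2 := (hasFDerivAt_affineQuaternion φ₂ p.2).hasMFDerivAt.comp p
    ((hcoe p.2).hasMFDerivAt.comp p (hasMFDerivAt_snd (I := 𝓡 2) (I' := 𝓡 2) p))
  have hG := hG1.mul' hG2
  have hcomp := hι.hasMFDerivAt.comp p hd.hasMFDerivAt
  -- The map into `ℍ` is differentiated twice: through the inclusion of `S³`, and by the product
  -- rule. Injectivity of the differential of the inclusion later brings the equation back to `S³`.
  have huniq := hasMFDerivAt_unique hcomp hG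
  have hz : mfderiv (𝓡 3) 𝓘(ℝ, ℍ[ℝ]) ((↑) : UnitQuaternion → ℍ[ℝ]) (productMap φ₁ φ₂ p) ξ ∈
      (ℝ ∙ (productMap φ₁ φ₂ p : ℍ[ℝ]))ᗮ := by
    rw [← range_mvfderiv_subtypeVal (n := 3)]
    exact ⟨ξ, rfl⟩
  obtain ⟨u, v, hu, hv, huv⟩ := exists_tangent_of_inner_eq_zero h₁ h₂ hne hne' _
    (Submodule.mem_orthogonal_singleton_iff_inner_right.mp hz)
  obtain ⟨s, rfl⟩ := mem_range_mfderiv_coe_imaginaryUnit hu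
  obtain ⟨t, rfl⟩ := mem_range_mfderiv_coe_imaginaryUnit hv
  refine ⟨(s, t), injective_mvfderiv_subtypeVal_sphere (n := 3) _ ?_⟩
  exact (DFunLike.congr_fun huniq (s, t)).trans huv

/-! ### Linear functionals on circles of latitude -/

/-- Expansion of `⟨b, c⟩` for `b ⟂ k` in the orthogonal basis `e`, `k × e` of the plane `k⊥`. -/
theorem inner_expansion_cross {e₁ e₂ e₃ b₁ b₂ b₃ k₁ k₂ k₃ : ℝ}
    (hk : k₁ ^ 2 + k₂ ^ 2 + k₃ ^ 2 = 1) (he : k₁ * e₁ + k₂ * e₂ + k₃ * e₃ = 0)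
    (hb : k₁ * b₁ + k₂ * b₂ + k₃ * b₃ = 0) (c₁ c₂ c₃ : ℝ) :
    (e₁ ^ 2 + e₂ ^ 2 + e₃ ^ 2) * (b₁ * c₁ + b₂ * c₂ + b₃ * c₃) =
      (e₁ * b₁ + e₂ * b₂ + e₃ * b₃) * (e₁ * c₁ + e₂ * c₂ + e₃ * c₃) +
      ((k₂ * e₃ - k₃ * e₂) * b₁ + (k₃ * e₁ - k₁ * e₃) * b₂ + (k₁ * e₂ - k₂ * e₁) * b₃) *
      ((k₂ * e₃ - k₃ * e₂) * c₁ + (k₃ * e₁ - k₁ * e₃) * c₂ + (k₁ * e₂ - k₂ * e₁) * c₃) := by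
  set l := (k₂ * e₃ - k₃ * e₂) * b₁ + (k₃ * e₁ - k₁ * e₃) * b₂ + (k₁ * e₂ - k₂ * e₁) * b₃ with hl
  -- Both `e` and `b` are orthogonal to the unit vector `k`, so e × b = l k. Lagrange's identity for
  -- (e × b) · (e × c) then gives the expansion.
  have h1 : e₂ * b₃ - e₃ * b₂ = l * k₁ := by
    rw [hl]
    linear_combination -(e₂ * b₃ - e₃ * b₂) * hk - hb * (k₂ * e₃ - k₃ * e₂) +
      he * (k₂ * b₃ - k₃ * b₂)
  have h2 : e₃ * b₁ - e₁ * b₃ = l * k₂ := by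
    rw [hl]
    linear_combination -(e₃ * b₁ - e₁ * b₃) * hk - hb * (k₃ * e₁ - k₁ * e₃) +
      he * (k₃ * b₁ - k₁ * b₃)
  have h3 : e₁ * b₂ - e₂ * b₁ = l * k₃ := by
    rw [hl]
    linear_combination -(e₁ * b₂ - e₂ * b₁) * hk - hb * (k₁ * e₂ - k₂ * e₁) +
      he * (k₁ * b₂ - k₂ * b₁)
  linear_combination (e₂ * c₃ - e₃ * c₂) * h1 + (e₃ * c₁ - e₁ * c₃) * h2 +
    (e₁ * c₂ - e₂ * c₁) * h3

/-- A sinusoid with a local maximum at `0` has there the maximum of its amplitude. -/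
theorem coeff_of_isLocalMax_sinusoid {a b c : ℝ}
    (h : IsLocalMax (fun t => a + Real.cos t * b + Real.sin t * c) 0) : c = 0 ∧ 0 ≤ b := by
  have hder : HasDerivAt (fun t => a + Real.cos t * b + Real.sin t * c) c 0 :=
    ((((Real.hasDerivAt_cos 0).mul_const b).const_add a).add
      ((Real.hasDerivAt_sin 0).mul_const c)).congr_deriv (by simp)
  have hc : c = 0 := h.hasDerivAt_eq_zero hder
  refine ⟨hc, ?_⟩
  have hmem : ∀ᶠ t : ℝ in 𝓝[>] 0, t ∈ Set.Ioo 0 Real.pi := Ioo_mem_nhdsGT Real.pi_pos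
  obtain ⟨t, ht, ht0⟩ := ((h.filter_mono nhdsWithin_le_nhds).and hmem).exists
  have hlt : Real.cos t < 1 := by
    rw [← Real.cos_zero]
    exact Real.cos_lt_cos_of_nonneg_of_le_pi le_rfl ht0.2.le ht0.1
  simp only [hc, Real.cos_zero, Real.sin_zero] at ht
  nlinarith

/-- A circle of latitude about the axis `k` through `m`, on which a local maximum at `m` of a
linear functional is a global one. -/
theorem exists_latitude_path {k m : pureQuaternions} (hk : ‖k‖ = 1) :
    ∃ γ : ℝ → pureQuaternions, Continuous γ ∧ γ 0 = m ∧ (∀ t, ‖γ t‖ = ‖m‖) ∧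
      (∀ t, inner ℝ (γ t) k = inner ℝ m k) ∧
      ∀ m' c : pureQuaternions, ‖m'‖ = ‖m‖ → inner ℝ m' k = inner ℝ m k →
        IsLocalMax (fun t => inner ℝ (γ t) c) 0 → inner ℝ m' c ≤ inner ℝ m c := by
  have hk1 : inner ℝ k k = 1 := by rw [real_inner_self_eq_norm_sq, hk, one_pow]
  have hkk := hk1
  rw [pureQuaternions_inner] at hkk
  set α := inner ℝ m k with hα
  let e : pureQuaternions := m - α • k
  -- This is k × e, a quarter turn of `e` about `k`.
  let h : pureQuaternions := ⟨((k : ℍ[ℝ]) * (e : ℍ[ℝ])).im, rfl⟩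
  have hek : inner ℝ e k = 0 := by
    simp only [e, inner_sub_left, pureQuaternions_inner_smul_left, hk1, ← hα]
    ring
  have hekc := hek
  rw [pureQuaternions_inner] at hekc
  have hI : (h : ℍ[ℝ]).imI = (k : ℍ[ℝ]).imJ * (e : ℍ[ℝ]).imK - (k : ℍ[ℝ]).imK * (e : ℍ[ℝ]).imJ := by
    simp [h, pureQuaternions_re]
  have hJ : (h : ℍ[ℝ]).imJ = (k : ℍ[ℝ]).imK * (e : ℍ[ℝ]).imI - (k : ℍ[ℝ]).imI * (e : ℍ[ℝ]).imK := by
    simp [h, pureQuaternions_re]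
    ring
  have hK : (h : ℍ[ℝ]).imK = (k : ℍ[ℝ]).imI * (e : ℍ[ℝ]).imJ - (k : ℍ[ℝ]).imJ * (e : ℍ[ℝ]).imI := by
    simp [h, pureQuaternions_re]
  have hhk : inner ℝ h k = 0 := by
    rw [pureQuaternions_inner, hI, hJ, hK]
    ring
  have hhe : inner ℝ h e = 0 := by
    rw [pureQuaternions_inner, hI, hJ, hK]
    ring
  have hhh : inner ℝ h h = inner ℝ e e := by
    rw [pureQuaternions_inner, pureQuaternions_inner, hI, hJ, hK]
    linear_combination ((e : ℍ[ℝ]).imI ^ 2 + (e : ℍ[ℝ]).imJ ^ 2 + (e : ℍ[ℝ]).imK ^ 2) * hkk -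
      ((e : ℍ[ℝ]).imI * (k : ℍ[ℝ]).imI + (e : ℍ[ℝ]).imJ * (k : ℍ[ℝ]).imJ +
        (e : ℍ[ℝ]).imK * (k : ℍ[ℝ]).imK) * hekc
  have hm : m = α • k + e := by simp [e]
  have hinner (t : ℝ) (c : pureQuaternions) :
      inner ℝ (α • k + Real.cos t • e + Real.sin t • h) c =
        α * inner ℝ k c + Real.cos t * inner ℝ e c + Real.sin t * inner ℝ h c := by
    simp only [inner_add_left, pureQuaternions_inner_smul_left]
  have hee : inner ℝ m m = α ^ 2 + inner ℝ e e := by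
    conv_lhs => rw [hm]
    simp only [inner_add_left, inner_add_right, pureQuaternions_inner_smul_left, pureQuaternions_inner_smul_right,
      real_inner_comm e k, hek, hk1]
    ring
  refine ⟨fun t => α • k + Real.cos t • e + Real.sin t • h, by fun_prop, ?_, ?_, ?_, ?_⟩
  · simp [e]
  · intro t
    have hsq : inner ℝ (α • k + Real.cos t • e + Real.sin t • h)
        (α • k + Real.cos t • e + Real.sin t • h) = inner ℝ m m := by
      rw [hee]
      simp only [inner_add_left, inner_add_right, pureQuaternions_inner_smul_left, pureQuaternions_inner_smul_right,
        real_inner_comm e k, real_inner_comm h k, real_inner_comm h e, hek, hk1, hhk, hhe, hhh]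
      linear_combination inner ℝ e e * Real.sin_sq_add_cos_sq t
    rw [real_inner_self_eq_norm_sq, real_inner_self_eq_norm_sq] at hsq
    exact (sq_eq_sq₀ (norm_nonneg _) (norm_nonneg _)).mp hsq
  · intro t
    rw [hinner, hek, hhk, hk1]
    ring
  · intro m' c hm' hm'k hmax
    simp only [hinner] at hmax
    obtain ⟨hC, hB⟩ := coeff_of_isLocalMax_sinusoid hmax
    let e' : pureQuaternions := m' - α • k
    have hm'e : m' = α • k + e' := by simp [e']
    have he'k : inner ℝ e' k = 0 := by
      simp only [e', inner_sub_left, pureQuaternions_inner_smul_left, hk1, hm'k]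
      ring
    have he'e' : inner ℝ e' e' = inner ℝ e e := by
      have h1 : inner ℝ m' m' = α ^ 2 + inner ℝ e' e' := by
        conv_lhs => rw [hm'e]
        simp only [inner_add_left, inner_add_right, pureQuaternions_inner_smul_left, pureQuaternions_inner_smul_right,
          real_inner_comm e' k, he'k, hk1]
        ring
      have h2 : inner ℝ m' m' = inner ℝ m m := by
        rw [real_inner_self_eq_norm_sq, real_inner_self_eq_norm_sq, hm']
      linarith
    have hle : inner ℝ e e' ≤ inner ℝ e e := by
      have h0 : 0 ≤ inner ℝ (e - e') (e - e') := real_inner_self_nonneg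
      simp only [inner_sub_left, inner_sub_right, real_inner_comm e e', he'e'] at h0
      linarith
    -- The vanishing derivative ⟨h, c⟩ = 0 removes the second term of the expansion of `e'` in the
    -- basis `e`, `h`.
    have hexp : inner ℝ e e * inner ℝ e' c = inner ℝ e e' * inner ℝ e c := by
      have he'kc := he'k
      rw [pureQuaternions_inner] at he'kc
      have hx := inner_expansion_cross (e₁ := (e : ℍ[ℝ]).imI) (e₂ := (e : ℍ[ℝ]).imJ)
        (e₃ := (e : ℍ[ℝ]).imK) (b₁ := (e' : ℍ[ℝ]).imI) (b₂ := (e' : ℍ[ℝ]).imJ)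
        (b₃ := (e' : ℍ[ℝ]).imK) (k₁ := (k : ℍ[ℝ]).imI) (k₂ := (k : ℍ[ℝ]).imJ)
        (k₃ := (k : ℍ[ℝ]).imK) (by linarith) (by linarith) (by linarith)
        (c : ℍ[ℝ]).imI (c : ℍ[ℝ]).imJ (c : ℍ[ℝ]).imK
      rw [pureQuaternions_inner, hI, hJ, hK] at hC
      rw [hC, mul_zero, add_zero] at hx
      simp only [pureQuaternions_inner]
      linarith
    have hgoal : inner ℝ e' c ≤ inner ℝ e c := by
      -- If `m` lies on the axis, the circle degenerates to a point.
      rcases (real_inner_self_nonneg (x := e)).eq_or_lt with h0 | h0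
      · have h1 : e = 0 := inner_self_eq_zero.mp h0.symm
        have h2 : e' = 0 := inner_self_eq_zero.mp (he'e'.trans h0.symm)
        rw [h1, h2]
      · refine le_of_mul_le_mul_left ?_ h0
        rw [hexp]
        exact mul_le_mul_of_nonneg_right hle hB
    rw [hm, hm'e, inner_add_left, inner_add_left]
    linarith

/-! ### Fibres of the product map -/

/-- The quaternion `y` solving `exp (φ₁ x) (cos φ₂ + sin φ₂ y) = w`. -/
def rightFactor (φ₁ φ₂ : ℝ) (w : ℍ[ℝ]) (x : pureQuaternions) : ℍ[ℝ] :=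
  (Real.sin φ₂)⁻¹ • (star (affineQuaternion φ₁ x) * w - ((Real.cos φ₂ : ℝ) : ℍ[ℝ]))

theorem continuous_rightFactor (φ₁ φ₂ : ℝ) (w : ℍ[ℝ]) : Continuous (rightFactor φ₁ φ₂ w) := by
  have h := (contDiff_affineQuaternion φ₁).continuous
  unfold rightFactor
  fun_prop

theorem rightFactor_productMap (φ₁ : ℝ) {φ₂ : ℝ} (h₂ : Real.sin φ₂ ≠ 0) (x y : ImaginaryUnit) :
    rightFactor φ₁ φ₂ (productMap φ₁ φ₂ (x, y)) x = (y : pureQuaternions) := by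
  have h := unitQuaternion_star_mul (expUnit φ₁ x)
  rw [coe_expUnit] at h
  rw [rightFactor, coe_productMap, ← mul_assoc, h, one_mul, affineQuaternion, add_sub_cancel_left,
    smul_smul, inv_mul_cancel₀ h₂, one_smul]

/-- The vector part of a quaternion. -/
def vectorPart (w : ℍ[ℝ]) : pureQuaternions := ⟨w.im, rfl⟩

/-- This is why fibres project to circles of latitude: the real part of the would-be second factor
depends on `x` only through its latitude about the axis `vectorPart w`. -/
theorem re_star_affineQuaternion_mul (φ : ℝ) (w : ℍ[ℝ]) (x : pureQuaternions) :
    (star (affineQuaternion φ x) * w).re =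
      Real.cos φ * w.re + Real.sin φ * inner ℝ x (vectorPart w) := by
  rw [pureQuaternions_inner]
  simp only [Quaternion.re_mul, Quaternion.re_star, Quaternion.imI_star, Quaternion.imJ_star,
    Quaternion.imK_star, affineQuaternion_re, affineQuaternion_imI, affineQuaternion_imJ,
    affineQuaternion_imK, vectorPart, Quaternion.imI_im, Quaternion.imJ_im, Quaternion.imK_im]
  ring

/-- The fibre of the product map through `(m, n)` projects onto the circle of latitude of `m`
about the axis of the product. -/
theorem exists_productMap_eq (φ₁ : ℝ) {φ₂ : ℝ} (h₂ : Real.sin φ₂ ≠ 0) (m n x : ImaginaryUnit)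
    (hx : inner ℝ (x : pureQuaternions) (vectorPart (productMap φ₁ φ₂ (m, n))) =
      inner ℝ (m : pureQuaternions) (vectorPart (productMap φ₁ φ₂ (m, n)))) :
    ∃ y : ImaginaryUnit, productMap φ₁ φ₂ (x, y) = productMap φ₁ φ₂ (m, n) := by
  set w := productMap φ₁ φ₂ (m, n) with hw
  set v := star (affineQuaternion φ₁ x) * (w : ℍ[ℝ]) with hv
  -- A unit quaternion with real part cos φ₂ is cos φ₂ + sin φ₂ y for an imaginary unit y; no other
  -- condition on `v` is needed.
  have hre : v.re = Real.cos φ₂ := by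
    rw [hv, re_star_affineQuaternion_mul, hx, ← re_star_affineQuaternion_mul, hw, coe_productMap,
      ← mul_assoc, ← coe_expUnit, unitQuaternion_star_mul, one_mul, affineQuaternion_re]
  have hnorm : Quaternion.normSq v = 1 := by
    rw [hv, map_mul, Quaternion.normSq_star, ← coe_expUnit, Quaternion.normSq_eq_norm_mul_self,
      Quaternion.normSq_eq_norm_mul_self, norm_eq_of_mem_sphere, norm_eq_of_mem_sphere]
    norm_num
  have hy0 : (rightFactor φ₁ φ₂ w x).re = 0 := by
    rw [rightFactor, ← hv, Quaternion.re_smul, Quaternion.re_sub, hre, Quaternion.re_coe, sub_self,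
      smul_zero]
  let y : pureQuaternions := ⟨rightFactor φ₁ φ₂ w x, hy0⟩
  have hsq : inner ℝ y y = 1 := by
    rw [Quaternion.normSq_def', hre] at hnorm
    rw [pureQuaternions_inner]
    simp only [y, rightFactor, ← hv, Quaternion.imI_smul, Quaternion.imJ_smul, Quaternion.imK_smul,
      Quaternion.imI_sub, Quaternion.imJ_sub, Quaternion.imK_sub, Quaternion.imI_coe,
      Quaternion.imJ_coe, Quaternion.imK_coe, smul_eq_mul, sub_zero]
    field_simp
    linear_combination hnorm - Real.sin_sq_add_cos_sq φ₂
  have hy : ‖y‖ = 1 := by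
    rw [real_inner_self_eq_norm_sq] at hsq
    exact (pow_eq_one_iff_of_nonneg (norm_nonneg _) two_ne_zero).mp hsq
  refine ⟨⟨y, mem_sphere_zero_iff_norm.mpr hy⟩, Subtype.ext ?_⟩
  have hV : affineQuaternion φ₂ y = v := by
    simp only [affineQuaternion, y, rightFactor, smul_smul, mul_inv_cancel₀ h₂, one_smul]
    abel
  have hU := unitQuaternion_mul_star (expUnit φ₁ x)
  rw [coe_expUnit] at hU
  rw [coe_productMap]
  change affineQuaternion φ₁ x * affineQuaternion φ₂ y = _
  rw [hV, hv, ← mul_assoc, hU, one_mul]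

/-- Pairing the vector part of the product with m × n leaves sin φ₁ sin φ₂ |m × n|², and |m × n|² =
1 - ⟨m, n⟩² > 0. So the latitude circles have a well-defined axis. -/
theorem vectorPart_productMap_ne_zero {φ₁ φ₂ : ℝ} (h₁ : Real.sin φ₁ ≠ 0) (h₂ : Real.sin φ₂ ≠ 0)
    {m n : ImaginaryUnit} (hne : m ≠ n) (hne' : m ≠ -n) :
    vectorPart (productMap φ₁ φ₂ (m, n)) ≠ 0 := by
  intro h
  have h' : (productMap φ₁ φ₂ (m, n) : ℍ[ℝ]).im = 0 := congrArg Subtype.val h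
  have hI := congrArg QuaternionAlgebra.imI h'
  have hJ := congrArg QuaternionAlgebra.imJ h'
  have hK := congrArg QuaternionAlgebra.imK h'
  have hmm := inner_self_imaginaryUnit m
  have hnn := inner_self_imaginaryUnit n
  have hmn := inner_sq_lt_one hne hne'
  rw [pureQuaternions_inner] at hmm hnn hmn
  simp only [coe_productMap, Quaternion.imI_im, Quaternion.imJ_im, Quaternion.imK_im,
    Quaternion.imI_mul, Quaternion.imJ_mul, Quaternion.imK_mul, affineQuaternion_re,
    affineQuaternion_imI, affineQuaternion_imJ, affineQuaternion_imK, Quaternion.imI_zero,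
    Quaternion.imJ_zero, Quaternion.imK_zero] at hI hJ hK
  set m₁ := ((m : pureQuaternions) : ℍ[ℝ]).imI
  set m₂ := ((m : pureQuaternions) : ℍ[ℝ]).imJ
  set m₃ := ((m : pureQuaternions) : ℍ[ℝ]).imK
  set n₁ := ((n : pureQuaternions) : ℍ[ℝ]).imI
  set n₂ := ((n : pureQuaternions) : ℍ[ℝ]).imJ
  set n₃ := ((n : pureQuaternions) : ℍ[ℝ]).imK
  have hX : Real.sin φ₁ * Real.sin φ₂ *
      ((m₂ * n₃ - m₃ * n₂) ^ 2 + (m₃ * n₁ - m₁ * n₃) ^ 2 + (m₁ * n₂ - m₂ * n₁) ^ 2) = 0 := by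
    linear_combination (m₂ * n₃ - m₃ * n₂) * hI + (m₃ * n₁ - m₁ * n₃) * hJ +
      (m₁ * n₂ - m₂ * n₁) * hK
  have hX0 := (mul_eq_zero.mp hX).resolve_left (mul_ne_zero h₁ h₂)
  have hL : 1 - (m₁ * n₁ + m₂ * n₂ + m₃ * n₃) ^ 2 = 0 := by
    linear_combination hX0 - hmm * (n₁ * n₁ + n₂ * n₂ + n₃ * n₃) - hnn
  linarith

/-- If no point of the fibre through `(m, n)` lies in both open caps, `m` lies on the boundary of
the first cap and `n` in the second open cap, then the fibre meets the first cap only in its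
boundary. -/
theorem mem_axisCircle_of_productMap_eq {φ₁ φ₂ : ℝ} (h₁ : Real.sin φ₁ ≠ 0) (h₂ : Real.sin φ₂ ≠ 0)
    {c₁ c₂ m n m' n' : ImaginaryUnit} {ξ₁ ξ₂ : ℝ} (hne : m ≠ n) (hne' : m ≠ -n)
    (hm : m ∈ axisCircle c₁ ξ₁)
    (hn : Real.cos ξ₂ < inner ℝ (n : pureQuaternions) (c₂ : pureQuaternions))
    (heq : productMap φ₁ φ₂ (m', n') = productMap φ₁ φ₂ (m, n)) (hm' : m' ∈ axisCap c₁ ξ₁)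
    (hempty : ∀ x y : ImaginaryUnit, productMap φ₁ φ₂ (x, y) = productMap φ₁ φ₂ (m, n) →
      Real.cos ξ₁ < inner ℝ (x : pureQuaternions) (c₁ : pureQuaternions) →
      inner ℝ (y : pureQuaternions) (c₂ : pureQuaternions) ≤ Real.cos ξ₂) :
    m' ∈ axisCircle c₁ ξ₁ := by
  set w := productMap φ₁ φ₂ (m, n) with hw
  have hk := vectorPart_productMap_ne_zero h₁ h₂ hne hne'
  rw [← hw] at hk
  set k := vectorPart w with hk_def
  have hk' : ‖k‖⁻¹ ≠ 0 := inv_ne_zero (norm_ne_zero_iff.mpr hk)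
  have hk1 : ‖‖k‖⁻¹ • k‖ = 1 := norm_smul_inv_norm (𝕜 := ℝ) hk
  obtain ⟨γ, hγ, hγ0, hγn, hγk, hmax⟩ :=
    exists_latitude_path (m := (m : pureQuaternions)) hk1
  have hlat : inner ℝ (m' : pureQuaternions) k = inner ℝ (m : pureQuaternions) k := by
    have hre (x y : ImaginaryUnit) (hxy : productMap φ₁ φ₂ (x, y) = w) :
        Real.cos φ₁ * (w : ℍ[ℝ]).re + Real.sin φ₁ * inner ℝ (x : pureQuaternions) k =
          Real.cos φ₂ := by
      rw [hk_def, ← re_star_affineQuaternion_mul, ← hxy, coe_productMap, ← mul_assoc,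
        ← coe_expUnit, unitQuaternion_star_mul, one_mul, affineQuaternion_re]
    exact mul_left_cancel₀ h₁ (add_left_cancel ((hre m' n' heq).trans (hre m n rfl).symm))
  have hle := hmax (m' : pureQuaternions) (c₁ : pureQuaternions)
    (by rw [norm_eq_of_mem_sphere, norm_eq_of_mem_sphere])
    (by rw [pureQuaternions_inner_smul_right, pureQuaternions_inner_smul_right, hlat]) ?_
  · exact le_antisymm (hle.trans hm.le) hm'
  -- Local maximality remains to be shown. `exists_productMap_eq` gives the second factor with no
  -- continuity in `t`; `rightFactor` gives it as a continuous function, which stays in the open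
  -- second cap for small `t`. Then `hempty` keeps `γ t` out of the open first cap.
  have hcont : Continuous fun t => inner ℝ (rightFactor φ₁ φ₂ w (γ t))
      ((c₂ : pureQuaternions) : ℍ[ℝ]) :=
    ((continuous_rightFactor φ₁ φ₂ w).comp hγ).inner continuous_const
  have hpos : Real.cos ξ₂ < inner ℝ (rightFactor φ₁ φ₂ w (γ 0))
      ((c₂ : pureQuaternions) : ℍ[ℝ]) := by
    rw [hγ0, hw, rightFactor_productMap φ₁ h₂, ← Submodule.coe_inner]
    exact hn
  filter_upwards [hcont.continuousAt.eventually (lt_mem_nhds hpos)] with t ht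
  by_contra! hlt
  rw [hγ0, hm] at hlt
  let x : ImaginaryUnit :=
    ⟨γ t, mem_sphere_zero_iff_norm.mpr ((hγn t).trans (norm_eq_of_mem_sphere m))⟩
  have hx : inner ℝ (x : pureQuaternions) k = inner ℝ (m : pureQuaternions) k := by
    have := hγk t
    rw [pureQuaternions_inner_smul_right, pureQuaternions_inner_smul_right] at this
    exact mul_left_cancel₀ hk' this
  obtain ⟨y, hy⟩ := exists_productMap_eq φ₁ h₂ m n x hx
  have hy' := hempty x y hy hlt
  have hyr := rightFactor_productMap φ₁ h₂ x y
  rw [hy, ← hw] at hyr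
  change Real.cos ξ₂ < inner ℝ (rightFactor φ₁ φ₂ w (x : pureQuaternions)) _ at ht
  rw [hyr, ← Submodule.coe_inner] at ht
  linarith

/-! ### Topology and separation of caps -/

/-- The imaginary units `m` with `⟨m, c⟩ > cos ξ`. -/
def openAxisCap (c : ImaginaryUnit) (ξ : ℝ) : Set ImaginaryUnit :=
  {m | Real.cos ξ < inner ℝ (m : pureQuaternions) (c : pureQuaternions)}

theorem isOpen_openAxisCap (c : ImaginaryUnit) (ξ : ℝ) : IsOpen (openAxisCap c ξ) :=
  isOpen_lt continuous_const (continuous_subtype_val.inner continuous_const)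

theorem isClosed_axisCap (c : ImaginaryUnit) (ξ : ℝ) : IsClosed (axisCap c ξ) :=
  isClosed_le continuous_const (continuous_subtype_val.inner continuous_const)

theorem isCompact_axisCap (c : ImaginaryUnit) (ξ : ℝ) : IsCompact (axisCap c ξ) := by
  have : FiniteDimensional ℝ pureQuaternions :=
    Module.finite_of_finrank_eq_succ finrank_pureQuaternions
  have : ProperSpace pureQuaternions := FiniteDimensional.proper ℝ _
  exact (isClosed_axisCap c ξ).isCompact

theorem openAxisCap_subset (c : ImaginaryUnit) (ξ : ℝ) : openAxisCap c ξ ⊆ axisCap c ξ :=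
  fun _ hm => (Set.mem_ofPred.mp hm).le

theorem axisCircle_subset (c : ImaginaryUnit) (ξ : ℝ) : axisCircle c ξ ⊆ axisCap c ξ :=
  fun _ hm => ge_of_eq hm

theorem mem_axisCircle_of_notMem_openAxisCap {c m : ImaginaryUnit} {ξ : ℝ} (hm : m ∈ axisCap c ξ)
    (h : m ∉ openAxisCap c ξ) : m ∈ axisCircle c ξ :=
  le_antisymm (not_lt.mp h) hm

theorem axisCap_subset_closure_openAxisCap (c : ImaginaryUnit) {ξ : ℝ}
    (hξ : ξ ∈ Set.Ioo 0 Real.pi) : axisCap c ξ ⊆ closure (openAxisCap c ξ) := by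
  intro m hm
  by_cases hopen : m ∈ openAxisCap c ξ
  · exact subset_closure hopen
  have hmc : inner ℝ (m : pureQuaternions) (c : pureQuaternions) = Real.cos ξ :=
    mem_axisCircle_of_notMem_openAxisCap hm hopen
  have hs : 0 < Real.sin ξ := Real.sin_pos_of_mem_Ioo hξ
  have hsc := Real.sin_sq_add_cos_sq ξ
  have hcm : inner ℝ (c : pureQuaternions) (m : pureQuaternions) = Real.cos ξ := by
    rw [real_inner_comm, hmc]
  -- The unit tangent at `m` pointing towards `c`. Along the great circle in this direction the
  -- angle to `c` drops from ξ to ξ - t.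
  let e : pureQuaternions :=
    (Real.sin ξ)⁻¹ • ((c : pureQuaternions) - Real.cos ξ • (m : pureQuaternions))
  have hem : inner ℝ e (m : pureQuaternions) = 0 := by
    simp only [e, pureQuaternions_inner_smul_left, inner_sub_left, inner_self_imaginaryUnit, hcm]
    ring
  have hec : inner ℝ e (c : pureQuaternions) = Real.sin ξ := by
    simp only [e, pureQuaternions_inner_smul_left, inner_sub_left, inner_self_imaginaryUnit, hmc]
    field_simp
    linarith
  have hee : inner ℝ e e = 1 := by
    have h1 : inner ℝ e e = (Real.sin ξ)⁻¹ * (inner ℝ e (c : pureQuaternions) -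
        Real.cos ξ * inner ℝ e (m : pureQuaternions)) := by
      conv_lhs => rw [show e = (Real.sin ξ)⁻¹ • ((c : pureQuaternions) -
        Real.cos ξ • (m : pureQuaternions)) from rfl, pureQuaternions_inner_smul_right,
        inner_sub_right, pureQuaternions_inner_smul_right]
    rw [h1, hec, hem]
    field_simp
    ring
  have hnorm (t : ℝ) : ‖Real.cos t • (m : pureQuaternions) + Real.sin t • e‖ = 1 := by
    have hsq : inner ℝ (Real.cos t • (m : pureQuaternions) + Real.sin t • e)
        (Real.cos t • (m : pureQuaternions) + Real.sin t • e) = 1 := by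
      simp only [inner_add_left, inner_add_right, pureQuaternions_inner_smul_left,
        pureQuaternions_inner_smul_right, inner_self_imaginaryUnit, hem, hee,
        real_inner_comm e (m : pureQuaternions)]
      linear_combination Real.sin_sq_add_cos_sq t
    rw [real_inner_self_eq_norm_sq] at hsq
    exact (pow_eq_one_iff_of_nonneg (norm_nonneg _) two_ne_zero).mp hsq
  let γ : ℝ → ImaginaryUnit := fun t =>
    ⟨Real.cos t • (m : pureQuaternions) + Real.sin t • e, mem_sphere_zero_iff_norm.mpr (hnorm t)⟩
  have hγ : Continuous γ := Continuous.subtype_mk (by fun_prop) _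
  have hγ0 : γ 0 = m := Subtype.ext (by simp [γ])
  have hlim : Tendsto γ (𝓝[>] 0) (𝓝 m) := by
    have h := hγ.tendsto 0
    rw [hγ0] at h
    exact h.mono_left nhdsWithin_le_nhds
  refine mem_closure_of_tendsto hlim ?_
  filter_upwards [Ioo_mem_nhdsGT hξ.1] with t ht
  have hval : inner ℝ (γ t : pureQuaternions) (c : pureQuaternions) = Real.cos (ξ - t) := by
    simp only [γ, inner_add_left, pureQuaternions_inner_smul_left, hmc, hec, Real.cos_sub]
    ring
  change Real.cos ξ < inner ℝ (γ t : pureQuaternions) (c : pureQuaternions)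
  rw [hval]
  exact Real.cos_lt_cos_of_nonneg_of_le_pi (by linarith [ht.2]) hξ.2.le (by linarith [ht.1])

/-- Chord at most arc: |m - c|² = 2 - 2⟨m, c⟩ ≤ 2 - 2 cos ξ ≤ ξ². -/
theorem norm_sub_le_of_mem_axisCap {c m : ImaginaryUnit} {ξ : ℝ} (hξ : 0 < ξ)
    (hm : m ∈ axisCap c ξ) : ‖(m : pureQuaternions) - (c : pureQuaternions)‖ ≤ ξ := by
  refine le_of_sq_le_sq ?_ hξ.le
  have hm' : Real.cos ξ ≤ inner ℝ (m : pureQuaternions) (c : pureQuaternions) := hm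
  rw [norm_sub_sq_real, norm_eq_of_mem_sphere, norm_eq_of_mem_sphere]
  linarith [Real.one_sub_sq_div_two_le_cos (x := ξ)]

/-- Small caps about axes `c₁ ≠ ±c₂` contain no pair of equal or opposite points. -/
theorem exists_axisCap_separation {c₁ c₂ : ImaginaryUnit} (hne : c₁ ≠ c₂) (hne' : c₁ ≠ -c₂) :
    ∃ ε : ℝ, 0 < ε ∧ ∀ ξ₁ ξ₂ : ℝ, 0 < ξ₁ → 0 < ξ₂ → ξ₁ < ε → ξ₂ < ε →
      ∀ m ∈ axisCap c₁ ξ₁, ∀ n ∈ axisCap c₂ ξ₂, m ≠ n ∧ m ≠ -n := by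
  have hpos : 0 < ‖(c₁ : pureQuaternions) - (c₂ : pureQuaternions)‖ :=
    norm_pos_iff.mpr (sub_ne_zero.mpr fun h => hne (Subtype.ext h))
  have hpos' : 0 < ‖(c₁ : pureQuaternions) + (c₂ : pureQuaternions)‖ :=
    norm_pos_iff.mpr fun h => hne' (Subtype.ext (eq_neg_of_add_eq_zero_left h))
  -- A common or opposite pair would give |c₁ ∓ c₂| ≤ ξ₁ + ξ₂ < 2ε, hence the half.
  refine ⟨min ‖(c₁ : pureQuaternions) - (c₂ : pureQuaternions)‖
    ‖(c₁ : pureQuaternions) + (c₂ : pureQuaternions)‖ / 2, by positivity, ?_⟩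
  intro ξ₁ ξ₂ h₁ h₂ hlt₁ hlt₂ m hm n hn
  have hm' := norm_sub_le_of_mem_axisCap h₁ hm
  have hn' := norm_sub_le_of_mem_axisCap h₂ hn
  have hmin := min_le_left ‖(c₁ : pureQuaternions) - (c₂ : pureQuaternions)‖
    ‖(c₁ : pureQuaternions) + (c₂ : pureQuaternions)‖
  have hmin' := min_le_right ‖(c₁ : pureQuaternions) - (c₂ : pureQuaternions)‖
    ‖(c₁ : pureQuaternions) + (c₂ : pureQuaternions)‖
  constructor
  · rintro rfl
    have h := norm_sub_le ((m : pureQuaternions) - (c₂ : pureQuaternions))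
      ((m : pureQuaternions) - (c₁ : pureQuaternions))
    rw [sub_sub_sub_cancel_left] at h
    linarith
  · rintro rfl
    have h := norm_add_le (((-n : ImaginaryUnit) : pureQuaternions) - (c₁ : pureQuaternions))
      ((n : pureQuaternions) - (c₂ : pureQuaternions))
    have heq : ((-n : ImaginaryUnit) : pureQuaternions) - (c₁ : pureQuaternions) +
        ((n : pureQuaternions) - (c₂ : pureQuaternions)) =
        -((c₁ : pureQuaternions) + (c₂ : pureQuaternions)) := by
      rw [coe_neg_sphere]
      abel
    rw [heq, norm_neg] at h
    linarith

theorem expUnit_image_mul_image (φ₁ φ₂ : ℝ) (A B : Set ImaginaryUnit) :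
    (expUnit φ₁ '' A) * (expUnit φ₂ '' B) = productMap φ₁ φ₂ '' (A ×ˢ B) := by
  rw [← Set.image2_mul, Set.image2_image_left, Set.image2_image_right, ← Set.image_prod]
  rfl

end

/-! ### The product of two small caps and its boundary -/

theorem mainTheorem8 (c₁ c₂ : ImaginaryUnit) (hne : c₁ ≠ c₂) (hne' : c₁ ≠ -c₂)
    (φ₁ φ₂ : ℝ) (hφ₁ : φ₁ ∈ Set.Ioo 0 Real.pi) (hφ₂ : φ₂ ∈ Set.Ioo 0 Real.pi) :
    ∃ ε : ℝ, 0 < ε ∧ ∀ ξ₁ ∈ Set.Ioo 0 Real.pi, ∀ ξ₂ ∈ Set.Ioo 0 Real.pi, ξ₁ < ε → ξ₂ < ε →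
      -- the product map on `S(c₁, φ₁, ξ₁) × S(c₂, φ₂, ξ₂)` is a submersion into `S³`
      IsSubmersionOn ((𝓡 2).prod (𝓡 2)) (𝓡 3) (productMap φ₁ φ₂)
        (axisCap c₁ ξ₁ ×ˢ axisCap c₂ ξ₂) ∧
      -- its image is the closure of an open subset of `S³`
      (∃ O : Set UnitQuaternion, IsOpen O ∧ capS c₁ φ₁ ξ₁ * capS c₂ φ₂ ξ₂ = closure O) ∧
      -- the boundary of the image lies in the union of the two pieces
      frontier (capS c₁ φ₁ ξ₁ * capS c₂ φ₂ ξ₂) ⊆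
        (capBoundary c₁ φ₁ ξ₁ * capS c₂ φ₂ ξ₂) ∪ (capS c₁ φ₁ ξ₁ * capBoundary c₂ φ₂ ξ₂) ∧
      -- the two pieces contain `bS₁ ⊗ bS₂`, and on the boundary they meet only there
      capBoundary c₁ φ₁ ξ₁ * capBoundary c₂ φ₂ ξ₂ ⊆
        (capBoundary c₁ φ₁ ξ₁ * capS c₂ φ₂ ξ₂) ∩ (capS c₁ φ₁ ξ₁ * capBoundary c₂ φ₂ ξ₂) ∧
      frontier (capS c₁ φ₁ ξ₁ * capS c₂ φ₂ ξ₂) ∩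
          ((capBoundary c₁ φ₁ ξ₁ * capS c₂ φ₂ ξ₂) ∩ (capS c₁ φ₁ ξ₁ * capBoundary c₂ φ₂ ξ₂)) =
        frontier (capS c₁ φ₁ ξ₁ * capS c₂ φ₂ ξ₂) ∩
          (capBoundary c₁ φ₁ ξ₁ * capBoundary c₂ φ₂ ξ₂) := by
  obtain ⟨ε, hε, hsep⟩ := exists_axisCap_separation hne hne'
  refine ⟨ε, hε, fun ξ₁ hξ₁ ξ₂ hξ₂ hlt₁ hlt₂ => ?_⟩
  replace hsep := hsep ξ₁ ξ₂ hξ₁.1 hξ₂.1 hlt₁ hlt₂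
  have h₁ : Real.sin φ₁ ≠ 0 := (Real.sin_pos_of_mem_Ioo hφ₁).ne'
  have h₂ : Real.sin φ₂ ≠ 0 := (Real.sin_pos_of_mem_Ioo hφ₂).ne'
  have hsmooth := contMDiff_productMap φ₁ φ₂
  have hsurj : ∀ p ∈ axisCap c₁ ξ₁ ×ˢ axisCap c₂ ξ₂,
      Function.Surjective (mfderiv ((𝓡 2).prod (𝓡 2)) (𝓡 3) (productMap φ₁ φ₂) p) :=
    fun p hp => surjective_mfderiv_productMap h₁ h₂ (hsep _ hp.1 _ hp.2).1 (hsep _ hp.1 _ hp.2).2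
  simp only [capS, capBoundary, expUnit_image_mul_image]
  set F := productMap φ₁ φ₂ with hF
  set K := F '' (axisCap c₁ ξ₁ ×ˢ axisCap c₂ ξ₂) with hK
  set O := F '' (openAxisCap c₁ ξ₁ ×ˢ openAxisCap c₂ ξ₂) with hO
  have hOK : O ⊆ K := Set.image_mono
    (Set.prod_mono (openAxisCap_subset c₁ ξ₁) (openAxisCap_subset c₂ ξ₂))
  have hOopen : IsOpen O := by
    rw [isOpen_iff_mem_nhds]
    rintro _ ⟨p, hp, rfl⟩
    have hp' : p ∈ axisCap c₁ ξ₁ ×ˢ axisCap c₂ ξ₂ :=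
      ⟨openAxisCap_subset _ _ hp.1, openAxisCap_subset _ _ hp.2⟩
    have hmap := ((hsmooth p).of_le (by exact_mod_cast le_top) :
      ContMDiffAt ((𝓡 2).prod (𝓡 2)) (𝓡 3) 1 F p).map_nhds_eq_of_surjective (hsurj p hp')
    rw [← hmap]
    exact image_mem_map (((isOpen_openAxisCap c₁ ξ₁).prod (isOpen_openAxisCap c₂ ξ₂)).mem_nhds hp)
  have hKclosed : IsClosed K :=
    (((isCompact_axisCap c₁ ξ₁).prod (isCompact_axisCap c₂ ξ₂)).image hsmooth.continuous).isClosed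
  have hKO : K = closure O := by
    refine subset_antisymm ?_ (closure_minimal hOK hKclosed)
    refine (Set.image_mono ?_).trans (image_closure_subset_closure_image hsmooth.continuous)
    rw [closure_prod_eq]
    exact Set.prod_mono (axisCap_subset_closure_openAxisCap c₁ hξ₁)
      (axisCap_subset_closure_openAxisCap c₂ hξ₂)
  have hfrontier : ∀ w ∈ frontier K, w ∉ O := by
    intro w hw hwO
    exact hw.2 (interior_maximal hOK hOopen hwO)
  have hsub : F '' (axisCircle c₁ ξ₁ ×ˢ axisCircle c₂ ξ₂) ⊆
      F '' (axisCircle c₁ ξ₁ ×ˢ axisCap c₂ ξ₂) ∩ F '' (axisCap c₁ ξ₁ ×ˢ axisCircle c₂ ξ₂) :=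
    Set.subset_inter (Set.image_mono (Set.prod_mono subset_rfl (axisCircle_subset _ _)))
      (Set.image_mono (Set.prod_mono (axisCircle_subset _ _) subset_rfl))
  refine ⟨⟨hsmooth, hsurj⟩, ⟨O, hOopen, hKO⟩, ?_, hsub,
    subset_antisymm ?_ (Set.inter_subset_inter_right _ hsub)⟩
  · intro w hw
    obtain ⟨p, hp, rfl⟩ := hKclosed.frontier_subset hw
    by_cases hp1 : p.1 ∈ openAxisCap c₁ ξ₁
    · have hp2 : p.2 ∉ openAxisCap c₂ ξ₂ := fun h => hfrontier _ hw ⟨p, ⟨hp1, h⟩, rfl⟩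
      exact Or.inr ⟨p, ⟨hp.1, mem_axisCircle_of_notMem_openAxisCap hp.2 hp2⟩, rfl⟩
    · exact Or.inl ⟨p, ⟨mem_axisCircle_of_notMem_openAxisCap hp.1 hp1, hp.2⟩, rfl⟩
  · rintro w ⟨hw, ⟨⟨m, n⟩, ⟨hm, hn⟩, rfl⟩, ⟨⟨m', n'⟩, ⟨hm', hn'⟩, heq⟩⟩
    refine ⟨hw, ?_⟩
    -- The two preimages of `w` may differ. If `n` is interior, `(m', n')` is the pair on both
    -- circles; otherwise `(m, n)` is.
    by_cases hn2 : n ∈ openAxisCap c₂ ξ₂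
    · obtain ⟨hmn, hmn'⟩ := hsep m (axisCircle_subset _ _ hm) n hn
      refine ⟨(m', n'), ⟨?_, hn'⟩, heq⟩
      refine mem_axisCircle_of_productMap_eq h₁ h₂ hmn hmn' hm hn2 heq hm' fun x y hxy hx => ?_
      by_contra! hy
      exact hfrontier _ hw ⟨(x, y), ⟨hx, hy⟩, hxy⟩
    · exact ⟨(m, n), ⟨hm, mem_axisCircle_of_notMem_openAxisCap hn hn2⟩, rfl⟩
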